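/- Let $E$ be a countable set, $r:E\times E\to\mathbb R$ with $r(x,x)=0$ for all $x$, and $V:E\to\mathbb R$, such that $\sup_{x}\sum_{y}|r(x,y)|<\infty$ and $\sup_x|V(x)|<\infty$. For bounded $f:E\to\mathbb R$ put $$Af(x)=\sum_{y\in E}r(x,y)\,[f(y)-f(x)]+V(x)f(x).$$ Then the sum converges absolutely, $A$ is a bounded linear operator on the space of bounded real functions on $E$ with the supremum norm, and $S_t=e^{tA}=\sum_{n\ge0}\frac{(tA)^n}{n!}$ ($t\ge 0$) is well defined (the series converges in operator norm). Write $r^+=\max(r,0)$, $r^-=\max(-r,0)$, and let $(\widehat X_t,Z_t)_{t\ge0}$ be a Markov process on the discrete space $E\times\{-1,+1\}$ with right-continuous paths, started at $(x,+1)$, with generator $$\widehat Lg(x,s)=\sum_{y\in E}r^+(x,y)\,[g(y,s)-g(x,s)]+\sum_{y\in E}r^-(x,y)\,[g(y,-s)-g(x,s)].$$ That is, its transition semigroup $(P_t)$ satisfies $(P_hg-g)/h\to\widehat Lg$ uniformly as $h\downarrow0$ for every bounded $g$. Let $\mathbb E_{x,+1}$ denote expectation for this process. Then for every bounded $f:E\to\mathbb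 R$, every $x\in E$ and every $t\ge0$, the random variable below is integrable and $$S_tf(x)=\mathbb E_{x,+1}\Big[Z_t\,f(\widehat X_t)\,\exp\Big(\int_0^t\Big(2\sum_{y\in E}r^-(\widehat X_u,y)+V(\widehat X_u)\Big)du\Big)\Big].$$ -/

import Mathlib

open MeasureTheory ProbabilityTheory Filter Topology
open scoped ENNReal NNReal

noncomputable section

namespace SignedRates

/-- The space of bounded real functions on `E` with the supremum norm. -/
abbrev BoundedFun (E : Type*) : Type _ := lp (fun _ : E => ℝ) ∞

/-- The positive part `r⁺(x,y) = max (r(x,y)) 0` of the rates. -/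
def rPos {E : Type*} (r : E → E → ℝ) (x y : E) : ℝ := max (r x y) 0

/-- The negative part `r⁻(x,y) = max (-r(x,y)) 0` of the rates. -/
def rNeg {E : Type*} (r : E → E → ℝ) (x y : E) : ℝ := max (-(r x y)) 0

/-- `A f (x) = ∑ y, r(x,y) (f(y) - f(x)) + V(x) f(x)`. -/
def signedOp {E : Type*} (r : E → E → ℝ) (V : E → ℝ) (f : E → ℝ) (x : E) : ℝ :=
  (∑' y, r x y * (f y - f x)) + V x * f x

/-- The set of signs `ℤˣ = {-1, +1}` carries the discrete σ-algebra. -/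
instance instDiscreteSigns : DiscreteMeasurableSpace ℤˣ where
  forall_measurableSet s :=
    ⟨Units.val '' s, MeasurableSet.of_discrete, Set.preimage_image_eq s Units.val_injective⟩

/-- The generator of the particle/antiparticle chain on `E × {-1, +1}`; the set of signs
`{-1, +1}` is the group of units `ℤˣ`. -/
def pairGen {E : Type*} (r : E → E → ℝ) (g : E × ℤˣ → ℝ) (p : E × ℤˣ) : ℝ :=
  (∑' y, rPos r p.1 y * (g (y, p.2) - g p)) + ∑' y, rNeg r p.1 y * (g (y, -p.2) - g p)

/-- A (time-homogeneous, conservative) Markov transition function `(P_t)_{t ≥ 0}` on `S`. -/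
structure IsTransitionFunction {S : Type*} [MeasurableSpace S]
    (P : ℝ≥0 → Kernel S S) : Prop where
  isMarkovKernel : ∀ t, IsMarkovKernel (P t)
  zero : P 0 = Kernel.id
  chapman_kolmogorov : ∀ s t, P (s + t) = P t ∘ₖ P s

/-- `G` is the generator, defined on all bounded functions, of the semigroup
`P_t g (x) = ∫ g(y) P_t(x, dy)`: for every bounded `g`, `(P_h g - g) / h → G g` in supremum norm
as `h ↓ 0`. -/
def HasGenerator {S : Type*} [MeasurableSpace S]
    (P : ℝ≥0 → Kernel S S) (G : (S → ℝ) → S → ℝ) : Prop :=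
  ∀ g : S → ℝ, (∃ C, ∀ x, |g x| ≤ C) →
    TendstoUniformly (fun (h : ℝ≥0) x => (h : ℝ)⁻¹ * ((∫ y, g y ∂(P h x)) - g x)) (G g) (𝓝[>] 0)

/-- The σ-algebra `σ(Y_u : u ≤ s)` generated by the process up to time `s`. -/
abbrev past {Ω S : Type*} [MeasurableSpace S] (Y : ℝ≥0 → Ω → S) (s : ℝ≥0) : MeasurableSpace Ω :=
  ⨆ u : ℝ≥0, ⨆ _ : u ≤ s, MeasurableSpace.comap (Y u) inferInstance

/-- Under `μ`, the process `Y` on the countable discrete space `S`, with right-continuous paths,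
is a Markov process with transition function `P` started at `x₀`. -/
structure IsMarkovProcess {Ω S : Type*} [MeasurableSpace Ω] [MeasurableSpace S]
    (μ : Measure Ω) (P : ℝ≥0 → Kernel S S) (x₀ : S) (Y : ℝ≥0 → Ω → S) : Prop where
  measurable : ∀ t, Measurable (Y t)
  -- right-continuity with respect to the discrete topology on `S`
  right_continuous : ∀ ω t, ∀ᶠ u in 𝓝[≥] t, Y u ω = Y t ω
  initial : ∀ᵐ ω ∂μ, Y 0 ω = x₀
  markov : ∀ s t, ∀ B : Set S, MeasurableSet B →
    μ⟦Y (s + t) ⁻¹' B | past Y s⟧ =ᵐ[μ] fun ω => (P t (Y s ω)).real B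

/-- Under `μ`, `Y` is the Markov process with generator `G` started at `x₀`. -/
def IsMarkovProcessWithGenerator {Ω S : Type*} [MeasurableSpace Ω] [MeasurableSpace S]
    (μ : Measure Ω) (G : (S → ℝ) → S → ℝ) (x₀ : S) (Y : ℝ≥0 → Ω → S) : Prop :=
  ∃ P : ℝ≥0 → Kernel S S,
    IsTransitionFunction P ∧ HasGenerator P G ∧ IsMarkovProcess μ P x₀ Y

end SignedRates

end

noncomputable section

namespace SignedRates

/-! ### Exponentials in Banach algebras and the Trotter formula. -/

section Banach

/-! Put `W x = 2 ∑ r⁻(x, y) + V x`. On an odd function `g (x, s) = s * f x`, a sign-flipping jump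
contributes `-s f(y) - s f(x) = -s (f(y) - f(x)) - 2 s f(x)`. The first term restores the negative
rate `-r⁻`, and the `2 ∑ r⁻` in `W` cancels the second. Hence the pair generator `L` plus
multiplication by `W` preserves odd functions and acts there as `A`
(`pairGen_add_potential_oddExt`). Exponentials inherit this intertwining, so `e^{tA} f (x)` is
`e^{t(L + W)}` applied to the odd extension, evaluated at `(x, +1)`.

It remains to represent `e^{t(L + W)}` probabilistically (`feynman_kac`). Since `L` is bounded, the
transition semigroup is `e^{tL}` by uniqueness for a linear ODE (`kernelOp_eq_exp`). Trotter's
formula gives `e^{t(L + W)} = lim (P_{t/n} e^{(t/n) W})^n`. By the Markov property, the `n`-th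
product is an expectation involving the exponential of a Riemann sum of `W` along the path
(`IsMarkovProcess.integral_prod`). Right-continuity in a discrete space makes the Riemann sums
converge for every path, and dominated convergence concludes. -/

theorem norm_pow_sub_pow_le {𝔸 : Type*} [NormedRing 𝔸] [NormOneClass 𝔸] {a b : 𝔸} {K : ℝ}
    (hK : 1 ≤ K) (ha : ‖a‖ ≤ K) (hb : ‖b‖ ≤ K) (n : ℕ) :
    ‖a ^ n - b ^ n‖ ≤ n * K ^ n * ‖a - b‖ := by
  have hK0 : 0 ≤ K := by linarith
  induction n with
  | zero => simp
  | succ n ih =>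
    have hbn : ‖b ^ n‖ ≤ K ^ (n + 1) :=
      ((norm_pow_le b n).trans (pow_le_pow_left₀ (norm_nonneg _) hb n)).trans
        (pow_le_pow_right₀ hK n.le_succ)
    have hsplit : a ^ (n + 1) - b ^ (n + 1) = a * (a ^ n - b ^ n) + (a - b) * b ^ n := by
      rw [pow_succ', pow_succ']; noncomm_ring
    calc ‖a ^ (n + 1) - b ^ (n + 1)‖
        ≤ ‖a‖ * ‖a ^ n - b ^ n‖ + ‖a - b‖ * ‖b ^ n‖ := by
          rw [hsplit]
          exact (norm_add_le _ _).trans (add_le_add (norm_mul_le _ _) (norm_mul_le _ _))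
      _ ≤ K * (n * K ^ n * ‖a - b‖) + ‖a - b‖ * K ^ (n + 1) := by gcongr
      _ = (n + 1 : ℕ) * K ^ (n + 1) * ‖a - b‖ := by push_cast; ring

variable {𝔸 : Type*} [NormedRing 𝔸] [NormedAlgebra ℝ 𝔸] [CompleteSpace 𝔸] [NormOneClass 𝔸]

theorem norm_exp_le_exp_norm (a : 𝔸) : ‖NormedSpace.exp a‖ ≤ Real.exp ‖a‖ := by
  have h := NormedSpace.exp_series_hasSum_exp' (𝕂 := ℝ) a
  have h2 := NormedSpace.exp_series_hasSum_exp' (𝕂 := ℝ) ‖a‖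
  rw [← Real.exp_eq_exp_ℝ] at h2
  refine h.norm_le_of_bounded h2 fun n => ?_
  rw [norm_smul, smul_eq_mul, norm_inv, RCLike.norm_natCast]
  gcongr
  exact norm_pow_le a n

/-- The **Lie–Trotter product formula** in a real Banach algebra. -/
theorem tendsto_trotter (a b : 𝔸) (t : ℝ) :
    Tendsto (fun n : ℕ => (NormedSpace.exp ((t / n) • a) * NormedSpace.exp ((t / n) • b)) ^ n)
      atTop (𝓝 (NormedSpace.exp (t • (a + b)))) := by
  -- The two sides agree to first order at `0`, so they differ by `o(h)`; the `n`-th powers at `h =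
  -- t / n` then differ by `n * o(1/n)`, up to a constant.
  have hd : HasDerivAt (fun h : ℝ => NormedSpace.exp (h • a) * NormedSpace.exp (h • b)
      - NormedSpace.exp (h • (a + b))) 0 0 := by
    have h1 := hasDerivAt_exp_smul_const a (0 : ℝ)
    have h2 := hasDerivAt_exp_smul_const b (0 : ℝ)
    have h3 := hasDerivAt_exp_smul_const (a + b) (0 : ℝ)
    refine ((h1.mul h2).sub h3).congr_deriv ?_
    simp only [zero_smul, NormedSpace.exp_zero, one_mul, mul_one, sub_self]
  have hlim : Tendsto (fun n : ℕ => t / (n : ℝ)) atTop (𝓝 0) :=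
    tendsto_const_div_atTop_nhds_zero_nat t
  have ho := (hasDerivAt_iff_isLittleO.1 hd).comp_tendsto hlim
  simp only [Function.comp_def, zero_smul, NormedSpace.exp_zero, mul_one, sub_self, sub_zero,
    smul_zero] at ho
  set F : ℕ → 𝔸 := fun n => NormedSpace.exp ((t / n) • a) * NormedSpace.exp ((t / n) • b) with hF
  set G : ℕ → 𝔸 := fun n => NormedSpace.exp ((t / n) • (a + b)) with hG
  have hGn : ∀ n : ℕ, n ≠ 0 → G n ^ n = NormedSpace.exp (t • (a + b)) := by
    intro n hn
    let _ : NormedAlgebra ℚ 𝔸 := NormedAlgebra.restrictScalars ℚ ℝ 𝔸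
    rw [hG]
    simp only
    rw [← NormedSpace.exp_nsmul, ← Nat.cast_smul_eq_nsmul ℝ, smul_smul,
      mul_div_cancel₀ _ (by exact_mod_cast hn)]
  have hsmall : Tendsto (fun n : ℕ => (n : ℝ) * ‖F n - G n‖) atTop (𝓝 0) := by
    have h1 : (fun n : ℕ => (n : ℝ) * ‖F n - G n‖) =o[atTop] fun n : ℕ => (n : ℝ) * (t / n) :=
      (Asymptotics.isBigO_refl _ _).mul_isLittleO ho.norm_left
    have h2 : (fun n : ℕ => (n : ℝ) * (t / n)) =O[atTop] fun _ => (1 : ℝ) := by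
      refine Asymptotics.IsBigO.of_bound |t| (Eventually.of_forall fun n => ?_)
      rcases eq_or_ne n 0 with rfl | hn
      · simp
      · rw [mul_div_cancel₀ _ (by exact_mod_cast hn)]; simp
    exact (Asymptotics.isLittleO_one_iff ℝ).1 (h1.trans_isBigO h2)
  set c : ℝ := ‖a‖ + ‖b‖ with hc
  have hdist : ∀ n : ℕ, n ≠ 0 → ‖F n ^ n - NormedSpace.exp (t • (a + b))‖
      ≤ Real.exp (|t| * c) * ((n : ℝ) * ‖F n - G n‖) := by
    intro n hn
    have hn' : (n : ℝ) ≠ 0 := by exact_mod_cast hn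
    -- With this `K`, the factor `K ^ n` in `norm_pow_sub_pow_le` equals `exp (|t| * c)` for every
    -- `n ≠ 0`.
    have hK : 1 ≤ Real.exp (|t / n| * c) := Real.one_le_exp (by positivity)
    have hFn : ‖F n‖ ≤ Real.exp (|t / n| * c) := by
      refine (norm_mul_le _ _).trans ?_
      rw [hc, mul_add, Real.exp_add]
      have ha := norm_exp_le_exp_norm ((t / n) • a)
      have hb := norm_exp_le_exp_norm ((t / n) • b)
      rw [norm_smul, Real.norm_eq_abs] at ha hb
      gcongr
    have hGb : ‖G n‖ ≤ Real.exp (|t / n| * c) := by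
      refine (norm_exp_le_exp_norm _).trans (Real.exp_le_exp.2 ?_)
      rw [norm_smul, Real.norm_eq_abs]
      gcongr
      exact norm_add_le _ _
    have h := norm_pow_sub_pow_le hK hFn hGb n
    rw [hGn n hn, ← Real.exp_nat_mul, abs_div, Nat.abs_cast] at h
    refine h.trans (le_of_eq ?_)
    have : (n : ℝ) * (|t| / n * c) = |t| * c := by field_simp
    rw [this]; ring
  rw [tendsto_iff_norm_sub_tendsto_zero]
  refine squeeze_zero' (Eventually.of_forall fun _ => norm_nonneg _)
    ((eventually_ne_atTop 0).mono hdist) ?_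
  simpa using hsmall.const_mul (Real.exp (|t| * c))

/-- Bounded operators intertwined by `J` have intertwined exponentials. -/
theorem exp_comp_eq_comp_exp {F G : Type*} [NormedAddCommGroup F] [NormedSpace ℝ F]
    [CompleteSpace F] [NormedAddCommGroup G] [NormedSpace ℝ G] [CompleteSpace G]
    {A : F →L[ℝ] F} {B : G →L[ℝ] G} {J : F →L[ℝ] G} (h : ∀ f, B (J f) = J (A f)) (t : ℝ) (f : F) :
    NormedSpace.exp (t • B) (J f) = J (NormedSpace.exp (t • A) f) := by
  have hpow : ∀ (n : ℕ) (f : F), ((t • B) ^ n) (J f) = J (((t • A) ^ n) f) := by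
    intro n
    induction n with
    | zero => intro f; simp
    | succ n ih =>
      intro f
      rw [pow_succ, pow_succ]
      simp only [mul_apply_eq_comp, smul_apply, h]
      rw [← map_smul, ih]
  have hB := (NormedSpace.exp_series_hasSum_exp' (𝕂 := ℝ) (t • B)).mapL
    (ContinuousLinearMap.apply ℝ G (J f))
  have hA := (NormedSpace.exp_series_hasSum_exp' (𝕂 := ℝ) (t • A)).mapL
    (J.comp (ContinuousLinearMap.apply ℝ F f))
  refine hB.unique ?_
  change HasSum _ (J (NormedSpace.exp (t • A) f)) at hA
  convert hA using 2 with n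
  simp [hpow]

end Banach

/-! ### The algebra of bounded functions and its multiplication operators. -/

section BoundedFun

variable {S S' : Type*}

theorem BoundedFun.abs_apply_le (f : BoundedFun S) (x : S) : |f x| ≤ ‖f‖ :=
  lp.norm_apply_le_norm ENNReal.top_ne_zero f x

/-- The element of `BoundedFun S` given by a bounded function. -/
def BoundedFun.mk (f : S → ℝ) (hf : ∃ C, ∀ x, |f x| ≤ C) : BoundedFun S :=
  ⟨f, memℓp_infty (by
    obtain ⟨C, hC⟩ := hf
    exact ⟨C, by rintro _ ⟨x, rfl⟩; exact hC x⟩)⟩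

/-- The bounded operator given by a linear transformation of functions that is bounded on
`BoundedFun S`. -/
def boundedOp (T : (S → ℝ) → S' → ℝ) (C : ℝ)
    (hadd : ∀ (f g : BoundedFun S) x, T (fun y => f y + g y) x = T f x + T g x)
    (hsmul : ∀ (c : ℝ) (f : BoundedFun S) x, T (fun y => c * f y) x = c * T f x)
    (hC : ∀ (f : BoundedFun S) x, |T f x| ≤ C * ‖f‖) : BoundedFun S →L[ℝ] BoundedFun S' :=
  LinearMap.mkContinuous
    { toFun := fun f => BoundedFun.mk (T f) ⟨_, hC f⟩
      map_add' := fun f g => by ext x; exact hadd f g x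
      map_smul' := fun c f => by ext x; exact hsmul c f x }
    -- The sign of `C` is not assumed, while the norm bound needs a nonnegative constant.
    (max C 0)
    fun f => lp.norm_le_of_forall_le (by positivity) fun x =>
      (hC f x).trans (mul_le_mul_of_nonneg_right (le_max_left _ _) (norm_nonneg _))

/-- Multiplication by a bounded function. -/
def mulOp (W : BoundedFun S) : BoundedFun S →L[ℝ] BoundedFun S :=
  ContinuousLinearMap.mul ℝ (BoundedFun S) W

@[simp] theorem mulOp_apply (W f : BoundedFun S) (x : S) : mulOp W f x = W x * f x := rfl

/-- Evaluation at a point is a continuous ring homomorphism, so it commutes with the exponential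
series. -/
theorem exp_apply (W : BoundedFun S) (x : S) : NormedSpace.exp W x = Real.exp (W x) := by
  let _ : NormedAlgebra ℚ (BoundedFun S) := NormedAlgebra.restrictScalars ℚ ℝ _
  let ev : BoundedFun S →+* ℝ :=
    { toFun := fun f => f x
      map_one' := rfl
      map_mul' := fun _ _ => rfl
      map_zero' := rfl
      map_add' := fun _ _ => rfl }
  have hev : Continuous ev :=
    (LinearMap.mkContinuous (⟨⟨fun f : BoundedFun S => f x, fun _ _ => rfl⟩, fun _ _ => rfl⟩ :
      BoundedFun S →ₗ[ℝ] ℝ) 1 fun f => by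
        rw [one_mul]; exact BoundedFun.abs_apply_le f x).continuous
  rw [Real.exp_eq_exp_ℝ]
  exact NormedSpace.map_exp ev hev W

theorem exp_mulOp_apply (W f : BoundedFun S) (h : ℝ) (x : S) :
    NormedSpace.exp (h • mulOp W) f x = Real.exp (h * W x) * f x := by
  let _ : NormedAlgebra ℚ (BoundedFun S) := NormedAlgebra.restrictScalars ℚ ℝ _
  let _ : NormedAlgebra ℚ (BoundedFun S →L[ℝ] BoundedFun S) :=
    NormedAlgebra.restrictScalars ℚ ℝ _
  let ι : BoundedFun S →+* (BoundedFun S →L[ℝ] BoundedFun S) :=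
    { toFun := mulOp
      map_one' := by ext f x; simp
      map_mul' := fun u v => by ext f x; simp [mul_assoc]
      map_zero' := by ext f x; simp
      map_add' := fun u v => by ext f x; simp [add_mul] }
  have hι : Continuous ι := (ContinuousLinearMap.mul ℝ (BoundedFun S)).continuous
  have h1 : h • mulOp W = ι (h • W) := by
    ext f x
    change h * (W x * f x) = (h * W x) * f x
    ring
  rw [h1, ← NormedSpace.map_exp ι hι]
  change NormedSpace.exp (h • W) x * f x = _
  rw [exp_apply]
  rfl

end BoundedFun

/-! ### Transition semigroups with a bounded generator. -/

section Semigroup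

variable {S : Type*} [MeasurableSpace S] [DiscreteMeasurableSpace S]

theorem BoundedFun.integrable (f : BoundedFun S) (ν : Measure S) [IsFiniteMeasure ν] :
    Integrable (fun y => f y) ν :=
  Integrable.of_bound Measurable.of_discrete.aestronglyMeasurable ‖f‖
    (Eventually.of_forall fun y => f.abs_apply_le y)

/-- The operator on bounded functions given by a Markov kernel. -/
def kernelOp (κ : Kernel S S) [IsMarkovKernel κ] : BoundedFun S →L[ℝ] BoundedFun S :=
  boundedOp (fun f x => ∫ y, f y ∂(κ x)) 1
    (fun f g x => integral_add (f.integrable _) (g.integrable _))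
    (fun c f x => integral_const_mul c _)
    (fun f x => by
      have h := norm_integral_le_of_norm_le_const (μ := κ x) (f := fun y => f y) (C := ‖f‖)
        (Eventually.of_forall fun y => f.abs_apply_le y)
      simpa using h)

@[simp] theorem kernelOp_apply (κ : Kernel S S) [IsMarkovKernel κ] (f : BoundedFun S) (x : S) :
    kernelOp κ f x = ∫ y, f y ∂(κ x) := rfl

theorem norm_kernelOp_apply_le (κ : Kernel S S) [IsMarkovKernel κ] (f : BoundedFun S) :
    ‖kernelOp κ f‖ ≤ ‖f‖ := by
  refine lp.norm_le_of_forall_le (norm_nonneg _) fun x => ?_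
  have h := norm_integral_le_of_norm_le_const (μ := κ x) (f := fun y => f y) (C := ‖f‖)
    (Eventually.of_forall fun y => f.abs_apply_le y)
  simpa using h

variable {P : ℝ≥0 → Kernel S S} [∀ t, IsMarkovKernel (P t)]

theorem kernelOp_add (hP : IsTransitionFunction P) (s t : ℝ≥0) (f : BoundedFun S) :
    kernelOp (P (s + t)) f = kernelOp (P s) (kernelOp (P t) f) := by
  ext x
  simp only [kernelOp_apply]
  rw [hP.chapman_kolmogorov]
  exact Kernel.integral_comp (f.integrable _)

theorem kernelOp_zero (hP : IsTransitionFunction P) (f : BoundedFun S) :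
    kernelOp (P 0) f = f := by
  ext x
  simp only [kernelOp_apply, hP.zero, Kernel.id_apply]
  exact integral_dirac _ _

/-- Uniform convergence on `S` is norm convergence in `BoundedFun S`, so the generator is a right
derivative at time `0` in the Banach space. -/
theorem tendsto_slope_kernelOp {G : (S → ℝ) → S → ℝ} (hG : HasGenerator P G)
    {L : BoundedFun S →L[ℝ] BoundedFun S} (hL : ∀ f x, L f x = G f x) (f : BoundedFun S) :
    Tendsto (fun h : ℝ≥0 => (h : ℝ)⁻¹ • (kernelOp (P h) f - f)) (𝓝[>] 0) (𝓝 (L f)) := by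
  have h := hG f ⟨‖f‖, f.abs_apply_le⟩
  rw [Metric.tendstoUniformly_iff] at h
  rw [Metric.tendsto_nhds]
  intro ε hε
  filter_upwards [h (ε / 2) (half_pos hε)] with t ht
  rw [dist_eq_norm]
  refine lt_of_le_of_lt (lp.norm_le_of_forall_le (half_pos hε).le fun x => ?_) (half_lt_self hε)
  have hx := (ht x).le
  rw [dist_comm, Real.dist_eq, ← hL] at hx
  exact hx

theorem tendsto_kernelOp_zero (hP : IsTransitionFunction P) {G : (S → ℝ) → S → ℝ}
    (hG : HasGenerator P G) {L : BoundedFun S →L[ℝ] BoundedFun S}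
    (hL : ∀ f x, L f x = G f x) (f : BoundedFun S) :
    Tendsto (fun h : ℝ≥0 => ‖kernelOp (P h) f - f‖) (𝓝 0) (𝓝 0) := by
  have h0 : Tendsto (fun h : ℝ≥0 => kernelOp (P h) f - f) (𝓝[>] 0) (𝓝 0) := by
    have h1 : Tendsto (fun h : ℝ≥0 => (h : ℝ)) (𝓝[>] 0) (𝓝 0) :=
      (NNReal.continuous_coe.tendsto' 0 0 rfl).mono_left nhdsWithin_le_nhds
    have h2 := h1.smul (tendsto_slope_kernelOp hG hL f)
    rw [zero_smul] at h2
    refine h2.congr' ?_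
    filter_upwards [self_mem_nhdsWithin] with h hh
    have : (h : ℝ) ≠ 0 := by exact_mod_cast (Set.mem_Ioi.1 hh).ne'
    rw [smul_smul, mul_inv_cancel₀ this, one_smul]
  have h3 : ContinuousWithinAt (fun h : ℝ≥0 => ‖kernelOp (P h) f - f‖) (Set.Ioi 0) 0 := by
    unfold ContinuousWithinAt
    simpa [kernelOp_zero hP] using h0.norm
  rw [continuousWithinAt_Ioi_iff_Ici] at h3
  have huniv : Set.Ici (0 : ℝ≥0) = Set.univ := Set.eq_univ_of_forall fun _ => Set.mem_Ici.2 zero_le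
  rw [huniv, continuousWithinAt_univ] at h3
  simpa [ContinuousAt, kernelOp_zero hP] using h3

/-- A transition semigroup with a bounded generator is the exponential of its generator. -/
theorem kernelOp_eq_exp (hP : IsTransitionFunction P) {G : (S → ℝ) → S → ℝ}
    (hG : HasGenerator P G) {L : BoundedFun S →L[ℝ] BoundedFun S}
    (hL : ∀ f x, L f x = G f x) (t : ℝ≥0) :
    kernelOp (P t) = NormedSpace.exp ((t : ℝ) • L) := by
  ext1 f
  -- Contractivity of `P s` carries continuity at time `0` to all times.
  have key : ∀ s h : ℝ≥0, ‖kernelOp (P (s + h)) f - kernelOp (P s) f‖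
      ≤ ‖kernelOp (P h) f - f‖ := fun s h => by
    rw [kernelOp_add hP, ← map_sub]
    exact norm_kernelOp_apply_le _ _
  have hcont : Continuous fun u : ℝ => kernelOp (P u.toNNReal) f := by
    refine Continuous.comp (g := fun u : ℝ≥0 => kernelOp (P u) f) ?_ continuous_real_toNNReal
    refine continuous_iff_continuousAt.2 fun s => ?_
    rw [ContinuousAt, tendsto_iff_norm_sub_tendsto_zero]
    -- With truncated subtraction, `(u - s) + (s - u)` is `|u - s|`.
    have h1 : Tendsto (fun u : ℝ≥0 => (u - s) + (s - u)) (𝓝 s) (𝓝 0) := by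
      have : Continuous fun u : ℝ≥0 => (u - s) + (s - u) := by fun_prop
      exact this.tendsto' s 0 (by simp)
    refine squeeze_zero (fun _ => norm_nonneg _) (fun u => ?_)
      ((tendsto_kernelOp_zero hP hG hL f).comp h1)
    rcases le_total s u with hsu | hsu
    · have := key s (u - s)
      rw [add_tsub_cancel_of_le hsu] at this
      simpa [tsub_eq_zero_of_le hsu] using this
    · have := key u (s - u)
      rw [add_tsub_cancel_of_le hsu, norm_sub_rev] at this
      simpa [tsub_eq_zero_of_le hsu] using this
  -- Only a right derivative is available; it suffices for ODE uniqueness with the Lipschitz field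
  -- `L`.
  have hderiv : ∀ s ∈ Set.Ico (0 : ℝ) t, HasDerivWithinAt
      (fun u : ℝ => kernelOp (P u.toNNReal) f) (L (kernelOp (P s.toNNReal) f)) (Set.Ici s) s := by
    intro s hs
    rw [← hasDerivWithinAt_Ioi_iff_Ici, hasDerivWithinAt_iff_tendsto_slope' (by simp)]
    have h1 : Tendsto (fun u : ℝ => (u - s).toNNReal) (𝓝[>] s) (𝓝[>] 0) := by
      refine tendsto_nhdsWithin_iff.2 ⟨?_, ?_⟩
      · have : Continuous fun u : ℝ => (u - s).toNNReal := by fun_prop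
        exact (this.tendsto' s 0 (by simp)).mono_left nhdsWithin_le_nhds
      · filter_upwards [self_mem_nhdsWithin] with u hu
        simpa using hu
    refine ((tendsto_slope_kernelOp hG hL (kernelOp (P s.toNNReal) f)).comp h1).congr' ?_
    filter_upwards [self_mem_nhdsWithin] with u hu
    have hu' : s < u := hu
    have h2 : u.toNNReal = (u - s).toNNReal + s.toNNReal := by
      rw [← Real.toNNReal_add (by linarith) hs.1, sub_add_cancel]
    simp only [Function.comp_apply, slope, vsub_eq_sub]
    rw [h2, kernelOp_add hP, Real.coe_toNNReal _ (by linarith)]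
  have hexp : ∀ s : ℝ, HasDerivAt (fun u : ℝ => NormedSpace.exp (u • L) f)
      (L (NormedSpace.exp (s • L) f)) s := fun s => by
    have h := (hasDerivAt_exp_smul_const' L s).clm_apply (hasDerivAt_const s f)
    simpa using h
  have h := ODE_solution_unique_of_mem_Icc_right (v := fun _ => L)
    (g := fun u : ℝ => NormedSpace.exp (u • L) f) (s := fun _ => Set.univ)
    (K := ‖L‖₊) (a := 0) (b := t) (fun _ _ => L.lipschitz.lipschitzOnWith) hcont.continuousOn
    hderiv (fun _ _ => trivial)
    (fun s _ => (hexp s).continuousAt.continuousWithinAt)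
    (fun s _ => (hexp s).hasDerivWithinAt) (fun _ _ => trivial)
    (by
      have h0 : (0 : ℝ) • L = 0 := zero_smul ℝ L
      rw [Real.toNNReal_zero, kernelOp_zero hP, h0, NormedSpace.exp_zero]
      rfl)
    (Set.right_mem_Icc.2 t.2)
  simpa using h

end Semigroup

/-! ### The Markov property for functions and for products along a time grid. -/

section Markov

variable {Ω S : Type*} [MeasurableSpace Ω] [MeasurableSpace S] [DiscreteMeasurableSpace S]
  {μ : Measure Ω} [IsProbabilityMeasure μ] {P : ℝ≥0 → Kernel S S} [∀ t, IsMarkovKernel (P t)]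
  {x₀ : S} {Y : ℝ≥0 → Ω → S}

theorem past_le {Ω S : Type*} [mΩ : MeasurableSpace Ω] [MeasurableSpace S] {Y : ℝ≥0 → Ω → S}
    (hY : ∀ t, Measurable (Y t)) (s : ℝ≥0) : past Y s ≤ mΩ :=
  iSup₂_le fun u _ => (hY u).comap_le

theorem measurable_past {Ω S : Type*} [MeasurableSpace S] (Y : ℝ≥0 → Ω → S) {u s : ℝ≥0}
    (h : u ≤ s) : Measurable[past Y s] (Y u) :=
  measurable_iff_comap_le.2 (le_iSup₂_of_le u h le_rfl)

/-- Integrating the conditional probabilities over `A` yields an identity of measures, from which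
integrals of bounded functions follow without approximation by simple functions. -/
theorem IsMarkovProcess.map_restrict (hY : IsMarkovProcess μ P x₀ Y) (s h : ℝ≥0) {A : Set Ω}
    (hA : MeasurableSet[past Y s] A) :
    (μ.restrict A).map (Y (s + h)) = ((μ.restrict A).map (Y s)).bind (P h) := by
  have hm := past_le hY.measurable s
  ext B hB
  have hB' : MeasurableSet (Y (s + h) ⁻¹' B) := hY.measurable _ hB
  have hint : Integrable ((Y (s + h) ⁻¹' B).indicator fun _ => (1 : ℝ)) μ :=
    (integrable_const 1).indicator hB'
  have h1 : (μ.restrict A).real (Y (s + h) ⁻¹' B) = ∫ ω in A, (P h (Y s ω)).real B ∂μ := by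
    rw [← integral_congr_ae (ae_restrict_of_ae (hY.markov s h B hB)),
      setIntegral_condExp hm hint hA, integral_indicator hB']
    simp
  have hmeas : Measurable fun y => (P h y).real B := Measurable.of_discrete
  rw [Measure.map_apply (hY.measurable _) hB, Measure.bind_apply hB (Kernel.aemeasurable _),
    lintegral_map (Kernel.measurable_coe _ hB) (hY.measurable s), ← ofReal_measureReal, h1,
    ofReal_integral_eq_lintegral_ofReal]
  · simp
  · refine Integrable.of_bound (hmeas.comp (hY.measurable s)).aestronglyMeasurable 1
      (Eventually.of_forall fun ω => ?_)
    simp [abs_of_nonneg measureReal_nonneg]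
  · exact Eventually.of_forall fun _ => measureReal_nonneg

theorem IsMarkovProcess.condExp_eq (hY : IsMarkovProcess μ P x₀ Y) (s h : ℝ≥0)
    (g : BoundedFun S) :
    μ[fun ω => g (Y (s + h) ω) | past Y s] =ᵐ[μ] fun ω => kernelOp (P h) g (Y s ω) := by
  have hm := past_le hY.measurable s
  have hbdd : ∀ (g : BoundedFun S) (u : ℝ≥0), Integrable (fun ω => g (Y u ω)) μ := fun g u =>
    Integrable.of_bound (Measurable.of_discrete.comp (hY.measurable u)).aestronglyMeasurable ‖g‖
      (Eventually.of_forall fun ω => g.abs_apply_le _)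
  refine (ae_eq_condExp_of_forall_setIntegral_eq hm (hbdd g _)
    (fun A _ _ => (hbdd _ s).integrableOn) (fun A hA _ => ?_) ?_).symm
  · rw [← integral_map (φ := Y s) (f := fun y => kernelOp (P h) g y) (hY.measurable s).aemeasurable
        Measurable.of_discrete.aestronglyMeasurable,
      ← integral_map (φ := Y (s + h)) (f := fun y => g y) (hY.measurable _).aemeasurable
        Measurable.of_discrete.aestronglyMeasurable, hY.map_restrict s h hA]
    -- Binding a measure is composition with a constant kernel.
    have h1 := Kernel.integral_comp (κ := Kernel.const Unit ((μ.restrict A).map (Y s)))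
      (η := P h) (a := ()) (f := fun y => g y) (by
        exact g.integrable _)
    rw [Kernel.comp_apply, Kernel.const_apply] at h1
    exact h1.symm
  · exact ((Measurable.of_discrete (f := fun y => kernelOp (P h) g y)).comp
      (measurable_past Y le_rfl)).aestronglyMeasurable

/-- The Markov property tested against a bounded weight depending on the past. -/
theorem IsMarkovProcess.integral_mul (hY : IsMarkovProcess μ P x₀ Y) (s h : ℝ≥0)
    (g : BoundedFun S) {H : Ω → ℝ} (hH : Measurable[past Y s] H) {C : ℝ} (hC : ∀ ω, |H ω| ≤ C) :
    ∫ ω, H ω * g (Y (s + h) ω) ∂μ = ∫ ω, H ω * kernelOp (P h) g (Y s ω) ∂μ := by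
  have hm := past_le hY.measurable s
  have hg : Integrable (fun ω => g (Y (s + h) ω)) μ :=
    Integrable.of_bound (Measurable.of_discrete.comp (hY.measurable _)).aestronglyMeasurable ‖g‖
      (Eventually.of_forall fun ω => g.abs_apply_le _)
  have hHg : Integrable (H * fun ω => g (Y (s + h) ω)) μ :=
    hg.bdd_mul (hH.mono hm le_rfl).aestronglyMeasurable (Eventually.of_forall hC)
  calc ∫ ω, H ω * g (Y (s + h) ω) ∂μ
      = ∫ ω, (μ[H * fun ω => g (Y (s + h) ω) | past Y s]) ω ∂μ := (integral_condExp hm).symm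
    _ = _ := by
      refine integral_congr_ae ?_
      filter_upwards [condExp_mul_of_stronglyMeasurable_left hH.stronglyMeasurable hHg hg,
        hY.condExp_eq s h g] with ω h1 h2
      rw [h1, Pi.mul_apply, h2]

/-- Expectations of multiplicative functionals along an arithmetic progression of times. -/
theorem IsMarkovProcess.integral_prod (hY : IsMarkovProcess μ P x₀ Y) (h : ℝ≥0)
    {m : S → ℝ} {C : ℝ} (hm : ∀ y, |m y| ≤ C) (D : BoundedFun S →L[ℝ] BoundedFun S)
    (hD : ∀ g y, D g y = m y * g y) (n : ℕ) (g : BoundedFun S) :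
    ∫ ω, (∏ k ∈ Finset.range n, m (Y ((k + 1) * h) ω)) * g (Y (n * h) ω) ∂μ
      = ((kernelOp (P h) * D) ^ n) g x₀ := by
  induction n generalizing g with
  | zero =>
    have h0 : ∫ ω, g (Y 0 ω) ∂μ = ∫ _, g x₀ ∂μ :=
      integral_congr_ae (hY.initial.mono fun ω hω => by simp only [hω])
    simpa using h0
  | succ n ih =>
    have hmeas : Measurable[past Y (n * h)] fun ω =>
        ∏ k ∈ Finset.range n, m (Y ((k + 1) * h) ω) := by
      refine Finset.measurable_fun_prod _ fun k hk => ?_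
      refine (Measurable.of_discrete (f := m)).comp (measurable_past Y ?_)
      have : (k : ℝ≥0) + 1 ≤ n := by exact_mod_cast Finset.mem_range.1 hk
      gcongr
    have hbd : ∀ ω, |∏ k ∈ Finset.range n, m (Y ((k + 1) * h) ω)| ≤ C ^ n := fun ω => by
      rw [Finset.abs_prod]
      exact (Finset.prod_le_prod (fun _ _ => abs_nonneg _) fun k _ => hm _).trans_eq (by simp)
    -- Conditioning at time `n * h` replaces the last factor by `P h (D g)`; the earlier weights use
    -- times at most `n * h`, so they belong to the past.
    rw [pow_succ, mul_apply_eq_comp, mul_apply_eq_comp, ← ih (kernelOp (P h) (D g)),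
      ← hY.integral_mul (n * h) h (D g) hmeas hbd]
    refine integral_congr_ae (Eventually.of_forall fun ω => ?_)
    have hn : ((n + 1 : ℕ) : ℝ≥0) * h = n * h + h := by push_cast; ring
    simp only [hn]
    rw [Finset.prod_range_succ, hD, add_one_mul]
    ring

end Markov

/-! ### Riemann sums along right-continuous paths. -/

section Riemann

/-- Rounding up to a grid of mesh `t / n` converges from the right. -/
theorem tendsto_ceil_mul_nhdsGE {t : ℝ} (ht : 0 < t) {u : ℝ} (hu : 0 ≤ u) :
    Tendsto (fun n : ℕ => (⌈u / (t / n)⌉₊ : ℝ) * (t / n)) atTop (𝓝[≥] u) := by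
  have hpos : ∀ n : ℕ, n ≠ 0 → 0 < t / n := fun n hn =>
    div_pos ht (by exact_mod_cast Nat.pos_of_ne_zero hn)
  have hlow : ∀ᶠ n : ℕ in atTop, u ≤ (⌈u / (t / n)⌉₊ : ℝ) * (t / n) := by
    filter_upwards [eventually_ne_atTop 0] with n hn
    exact (div_le_iff₀ (hpos n hn)).1 (Nat.le_ceil _)
  refine tendsto_nhdsWithin_iff.2 ⟨?_, hlow⟩
  have hlim : Tendsto (fun n : ℕ => u + t / n) atTop (𝓝 u) := by
    simpa using (tendsto_const_div_atTop_nhds_zero_nat t).const_add u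
  refine tendsto_of_tendsto_of_tendsto_of_le_of_le' tendsto_const_nhds hlim hlow ?_
  filter_upwards [eventually_ne_atTop 0] with n hn
  have h := (Nat.ceil_lt_add_one (div_nonneg hu (hpos n hn).le)).le
  have h2 := mul_le_mul_of_nonneg_right h (hpos n hn).le
  rwa [add_one_mul, div_mul_cancel₀ _ (hpos n hn).ne'] at h2

/-- The step function `u ↦ φ (⌈u / h⌉ h)` integrates to a Riemann sum with right endpoints. -/
theorem integral_ceil_step (φ : ℝ → ℝ) {h : ℝ} (hh : 0 < h) (n : ℕ) :
    ∫ u in (0 : ℝ)..n * h, φ (⌈u / h⌉₊ * h) = ∑ k ∈ Finset.range n, h * φ ((k + 1) * h) := by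
  have hcongr : ∀ k : ℕ, Set.EqOn (fun u : ℝ => φ (⌈u / h⌉₊ * h)) (fun _ => φ ((k + 1) * h))
      (Set.uIoc (k * h) ((k + 1 : ℕ) * h)) := by
    intro k u hu
    rw [Set.uIoc_of_le (by push_cast; nlinarith)] at hu
    -- On the half-open cell `(k h, (k + 1) h]` the ceiling is constantly `k + 1`.
    have hc : ⌈u / h⌉₊ = k + 1 := by
      rw [Nat.ceil_eq_iff (Nat.succ_ne_zero k)]
      refine ⟨?_, ?_⟩
      · rw [lt_div_iff₀ hh]; simpa using hu.1
      · rw [div_le_iff₀ hh]; exact hu.2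
    simp only [hc]
    push_cast
    rfl
  have hsum := intervalIntegral.sum_integral_adjacent_intervals (μ := volume)
    (f := fun u : ℝ => φ (⌈u / h⌉₊ * h)) (a := fun k : ℕ => (k : ℝ) * h) (n := n)
    (fun k _ => (intervalIntegrable_congr (hcongr k)).2 intervalIntegrable_const)
  simp only [Nat.cast_zero, zero_mul] at hsum
  rw [← hsum]
  refine Finset.sum_congr rfl fun k _ => ?_
  rw [intervalIntegral.integral_congr_ae (Eventually.of_forall (hcongr k)),
    intervalIntegral.integral_const]
  push_cast
  rw [smul_eq_mul]
  ring

variable {S : Type*} {y : ℝ≥0 → S}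

/-- Grid points reach `u` from the right, where the path is locally constant, so the values are
eventually equal and `w` needs no regularity. -/
theorem tendsto_step_of_rightContinuous (hy : ∀ t, ∀ᶠ u in 𝓝[≥] t, y u = y t) (w : S → ℝ) {t : ℝ}
    (ht : 0 < t) {u : ℝ} (hu : 0 ≤ u) :
    Tendsto (fun n : ℕ => w (y ((⌈u / (t / n)⌉₊ : ℝ) * (t / n)).toNNReal)) atTop
      (𝓝 (w (y u.toNNReal))) := by
  have h1 : Tendsto Real.toNNReal (𝓝[≥] u) (𝓝[≥] u.toNNReal) :=
    tendsto_nhdsWithin_iff.2 ⟨continuous_real_toNNReal.continuousAt.mono_left nhdsWithin_le_nhds,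
      by filter_upwards [self_mem_nhdsWithin] with v hv using Real.toNNReal_le_toNNReal hv⟩
  refine tendsto_const_nhds.congr' ?_
  filter_upwards [(h1.comp (tendsto_ceil_mul_nhdsGE ht hu)).eventually (hy u.toNNReal)] with n hn
  exact congrArg w hn.symm

/-- The step approximations factor through `ℕ` and are therefore measurable; the limit inherits
this. -/
theorem aestronglyMeasurable_of_rightContinuous (hy : ∀ t, ∀ᶠ u in 𝓝[≥] t, y u = y t)
    (w : S → ℝ) (t : ℝ) :
    AEStronglyMeasurable (fun u : ℝ => w (y u.toNNReal)) (volume.restrict (Set.Ioc 0 t)) := by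
  refine aestronglyMeasurable_of_tendsto_ae atTop
    (f := fun (n : ℕ) (u : ℝ) => w (y ((⌈u / (1 / n)⌉₊ : ℝ) * (1 / n)).toNNReal)) (fun n => ?_) ?_
  · have hk : Measurable fun k : ℕ => w (y ((k : ℝ) * (1 / n)).toNNReal) := Measurable.of_discrete
    exact (hk.comp (Nat.measurable_ceil.comp (measurable_id.div_const _))).aestronglyMeasurable
  · filter_upwards [ae_restrict_mem measurableSet_Ioc] with u hu
    exact tendsto_step_of_rightContinuous hy w one_pos hu.1.le

theorem intervalIntegrable_of_rightContinuous (hy : ∀ t, ∀ᶠ u in 𝓝[≥] t, y u = y t)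
    {w : S → ℝ} {C : ℝ} (hw : ∀ x, |w x| ≤ C) {t : ℝ} (ht : 0 ≤ t) :
    IntervalIntegrable (fun u : ℝ => w (y u.toNNReal)) volume 0 t := by
  rw [intervalIntegrable_iff_integrableOn_Ioc_of_le ht]
  exact Integrable.of_bound (aestronglyMeasurable_of_rightContinuous hy w t) C
    (Eventually.of_forall fun u => hw _)

/-- Right-endpoint Riemann sums along a right-continuous path in a discrete space converge. -/
theorem tendsto_riemannSum (hy : ∀ t, ∀ᶠ u in 𝓝[≥] t, y u = y t)
    {w : S → ℝ} {C : ℝ} (hw : ∀ x, |w x| ≤ C) (t : ℝ≥0) :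
    Tendsto (fun n : ℕ => ∑ k ∈ Finset.range n, (t / n : ℝ) * w (y ((k + 1) * (t / n))))
      atTop (𝓝 (∫ u in (0 : ℝ)..t, w (y u.toNNReal))) := by
  rcases eq_or_lt_of_le (zero_le : 0 ≤ t) with rfl | ht
  · simp
  have ht' : (0 : ℝ) < t := ht
  have hlim : Tendsto (fun n : ℕ => ∫ u in (0 : ℝ)..t,
      w (y ((⌈u / (t / n)⌉₊ : ℝ) * (t / n)).toNNReal)) atTop
      (𝓝 (∫ u in (0 : ℝ)..t, w (y u.toNNReal))) := by
    refine intervalIntegral.tendsto_integral_filter_of_dominated_convergence (fun _ => C)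
      (Eventually.of_forall fun n => ?_) (Eventually.of_forall fun n =>
        Eventually.of_forall fun u _ => hw _) intervalIntegrable_const
      (Eventually.of_forall fun u hu => ?_)
    · have hk : Measurable fun k : ℕ => w (y ((k : ℝ) * (t / n)).toNNReal) :=
        Measurable.of_discrete
      exact (hk.comp (Nat.measurable_ceil.comp (measurable_id.div_const _))).aestronglyMeasurable
    · rw [Set.uIoc_of_le ht'.le] at hu
      exact tendsto_step_of_rightContinuous hy w ht' hu.1.le
  refine hlim.congr' ?_
  filter_upwards [eventually_ne_atTop 0] with n hn
  have hn' : (n : ℝ) ≠ 0 := by exact_mod_cast hn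
  have h := integral_ceil_step (fun v => w (y v.toNNReal)) (h := t / n)
    (div_pos ht' (by positivity)) n
  rw [mul_div_cancel₀ _ hn'] at h
  rw [h]
  refine Finset.sum_congr rfl fun k _ => ?_
  congr 3
  rw [Real.toNNReal_eq_iff_eq_coe (by positivity)]
  push_cast
  rfl

end Riemann

/-! ### The Feynman–Kac formula. -/

section FeynmanKac

variable {Ω S : Type*} [MeasurableSpace Ω] [MeasurableSpace S] [DiscreteMeasurableSpace S]
  {μ : Measure Ω} [IsProbabilityMeasure μ] {P : ℝ≥0 → Kernel S S} {x₀ : S} {Y : ℝ≥0 → Ω → S}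

/-- The **Feynman–Kac formula** for a jump process with bounded generator. -/
theorem feynman_kac (hP : IsTransitionFunction P) {G : (S → ℝ) → S → ℝ} (hG : HasGenerator P G)
    (hY : IsMarkovProcess μ P x₀ Y) {L : BoundedFun S →L[ℝ] BoundedFun S}
    (hL : ∀ f x, L f x = G f x) (W g : BoundedFun S) (t : ℝ≥0) :
    Integrable (fun ω => g (Y t ω) * Real.exp (∫ u in (0 : ℝ)..t, W (Y u.toNNReal ω))) μ ∧
      NormedSpace.exp ((t : ℝ) • (L + mulOp W)) g x₀
        = ∫ ω, g (Y t ω) * Real.exp (∫ u in (0 : ℝ)..t, W (Y u.toNNReal ω)) ∂μ := by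
  have _ := hP.isMarkovKernel
  -- The operator algebra has a unit of norm one only over a nontrivial space, and `tendsto_trotter`
  -- needs such a unit.
  have _ : Nonempty S := ⟨x₀⟩
  have _ : Nontrivial (BoundedFun S) := NormOneClass.nontrivial
  set Φ : ℕ → Ω → ℝ := fun n ω =>
    (∏ k ∈ Finset.range n, Real.exp ((t / n : ℝ) * W (Y ((k + 1) * (t / n)) ω)))
      * g (Y (n * (t / n)) ω) with hΦ
  set Ψ : Ω → ℝ := fun ω => g (Y t ω) * Real.exp (∫ u in (0 : ℝ)..t, W (Y u.toNNReal ω)) with hΨ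
  have hlim : ∀ ω, Tendsto (fun n => Φ n ω) atTop (𝓝 (Ψ ω)) := fun ω => by
    have h1 := ((Real.continuous_exp.tendsto _).comp
      (tendsto_riemannSum (fun s => hY.right_continuous ω s) W.abs_apply_le t)).const_mul
        (g (Y t ω))
    refine h1.congr' ?_
    filter_upwards [eventually_ne_atTop 0] with n hn
    have hn' : (n : ℝ≥0) ≠ 0 := by exact_mod_cast hn
    simp only [hΦ, Function.comp_apply]
    rw [Real.exp_sum, mul_div_cancel₀ _ hn', mul_comm]
  have hexp : ∀ (n : ℕ) (y : S), |Real.exp ((t / n : ℝ) * W y)| ≤ Real.exp ((t / n : ℝ) * ‖W‖) :=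
    fun n y => by
      rw [Real.abs_exp, Real.exp_le_exp]
      exact mul_le_mul_of_nonneg_left ((le_abs_self _).trans (W.abs_apply_le y)) (by positivity)
  -- The `n` weights are each at most `exp (t * ‖W‖ / n)`, so the bound is uniform in `n`.
  have hbound : ∀ n ω, ‖Φ n ω‖ ≤ Real.exp (t * ‖W‖) * ‖g‖ := fun n ω => by
    rw [norm_mul, Real.norm_eq_abs, Real.norm_eq_abs, Finset.abs_prod]
    refine mul_le_mul ?_ (g.abs_apply_le _) (abs_nonneg _) (Real.exp_pos _).le
    refine (Finset.prod_le_prod (fun _ _ => abs_nonneg _) fun k _ => hexp n _).trans ?_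
    rw [Finset.prod_const, Finset.card_range, ← Real.exp_nat_mul, Real.exp_le_exp]
    rcases eq_or_ne n 0 with rfl | hn
    · simp; positivity
    · have hn' : (n : ℝ) ≠ 0 := by exact_mod_cast hn
      exact le_of_eq (by field_simp)
  have hmeas : ∀ n, AEStronglyMeasurable (Φ n) μ := fun n => by
    refine Measurable.aestronglyMeasurable (Measurable.mul ?_ ?_)
    · exact Finset.measurable_fun_prod _ fun k _ => (Measurable.of_discrete
        (f := fun y => Real.exp ((t / n : ℝ) * W y))).comp (hY.measurable _)
    · exact (Measurable.of_discrete (f := fun y => g y)).comp (hY.measurable _)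
  have hΨmeas : AEStronglyMeasurable Ψ μ :=
    aestronglyMeasurable_of_tendsto_ae atTop hmeas (Eventually.of_forall hlim)
  refine ⟨Integrable.of_bound hΨmeas (Real.exp (t * ‖W‖) * ‖g‖) (Eventually.of_forall fun ω =>
    le_of_tendsto (hlim ω).norm (Eventually.of_forall fun n => hbound n ω)), ?_⟩
  have h1 : Tendsto (fun n => ∫ ω, Φ n ω ∂μ) atTop (𝓝 (∫ ω, Ψ ω ∂μ)) :=
    tendsto_integral_of_dominated_convergence (fun _ => Real.exp (t * ‖W‖) * ‖g‖) hmeas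
      (integrable_const _) (fun n => Eventually.of_forall (hbound n)) (Eventually.of_forall hlim)
  have hint : ∀ n : ℕ, ∫ ω, Φ n ω ∂μ = ((NormedSpace.exp ((t / n : ℝ) • L)
      * NormedSpace.exp ((t / n : ℝ) • mulOp W)) ^ n) g x₀ := fun n => by
    rw [hΦ, hY.integral_prod (t / n) (hexp n) _ (fun g y => exp_mulOp_apply W g (t / n : ℝ) y),
      kernelOp_eq_exp hP hG hL]
    norm_cast
  have h2 := tendsto_trotter L (mulOp W) (t : ℝ)
  have hev : Continuous fun T : BoundedFun S →L[ℝ] BoundedFun S => T g x₀ := by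
    have hc : Continuous fun f : BoundedFun S => f x₀ :=
      (LinearMap.mkContinuous (⟨⟨fun f : BoundedFun S => f x₀, fun _ _ => rfl⟩, fun _ _ => rfl⟩ :
        BoundedFun S →ₗ[ℝ] ℝ) 1 fun f => by
          rw [one_mul]; exact BoundedFun.abs_apply_le f x₀).continuous
    exact hc.comp (ContinuousLinearMap.apply ℝ _ g).continuous
  simp_rw [hint] at h1
  exact tendsto_nhds_unique ((hev.tendsto _).comp h2) h1

end FeynmanKac

/-! ### Summable rates and the operators they define. -/

section SummableWeights

variable {E : Type*} {a d : E → ℝ} {R c : ℝ}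

theorem summable_mul_of_bounded (ha : Summable fun y => |a y|) (hd : ∀ y, |d y| ≤ c) :
    Summable fun y => a y * d y :=
  Summable.of_norm_bounded (ha.mul_right c) fun y => by
    rw [Real.norm_eq_abs, abs_mul]
    exact mul_le_mul_of_nonneg_left (hd y) (abs_nonneg _)

theorem abs_tsum_mul_le (ha : Summable fun y => |a y|) (hR : ∑' y, |a y| ≤ R) (hc : 0 ≤ c)
    (hd : ∀ y, |d y| ≤ c) : |∑' y, a y * d y| ≤ R * c :=
  (tsum_of_norm_bounded (ha.mul_right c).hasSum fun y => by
    rw [Real.norm_eq_abs, abs_mul]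
    exact mul_le_mul_of_nonneg_left (hd y) (abs_nonneg _)).trans
  ((tsum_mul_right).trans_le (mul_le_mul_of_nonneg_right hR hc))

end SummableWeights

section Rates

theorem abs_rPos_le {E : Type*} (r : E → E → ℝ) (x y : E) : |rPos r x y| ≤ |r x y| := by
  rw [rPos, abs_of_nonneg (le_max_right _ _)]
  exact max_le (le_abs_self _) (abs_nonneg _)

theorem abs_rNeg_le {E : Type*} (r : E → E → ℝ) (x y : E) : |rNeg r x y| ≤ |r x y| := by
  rw [rNeg, abs_of_nonneg (le_max_right _ _)]
  exact max_le (neg_le_abs _) (abs_nonneg _)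

theorem rPos_sub_rNeg {E : Type*} (r : E → E → ℝ) (x y : E) :
    rPos r x y - rNeg r x y = r x y := by
  exact posPart_sub_negPart (r x y)

/-- The rates have absolutely summable rows, with sums bounded by `R`. -/
structure RowBound {E : Type*} (r : E → E → ℝ) (R : ℝ) : Prop where
  summable : ∀ x, Summable fun y => |r x y|
  tsum_le : ∀ x, ∑' y, |r x y| ≤ R

variable {E : Type*} {r q : E → E → ℝ} {R K : ℝ} {V : E → ℝ}

theorem RowBound.mono (hr : RowBound r R) (h : ∀ x y, |q x y| ≤ |r x y|) : RowBound q R where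
  summable x := (hr.summable x).of_nonneg_of_le (fun _ => abs_nonneg _) (h x)
  tsum_le x := (Summable.tsum_le_tsum (h x)
    ((hr.summable x).of_nonneg_of_le (fun _ => abs_nonneg _) (h x)) (hr.summable x)).trans
    (hr.tsum_le x)

theorem RowBound.rPos (hr : RowBound r R) : RowBound (rPos r) R := hr.mono (abs_rPos_le r)

theorem RowBound.rNeg (hr : RowBound r R) : RowBound (rNeg r) R := hr.mono (abs_rNeg_le r)

theorem BoundedFun.abs_sub_le {S : Type*} (f : BoundedFun S) (x y : S) :
    |f y - f x| ≤ 2 * ‖f‖ := by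
  have h1 := abs_sub (f y) (f x)
  linarith [f.abs_apply_le x, f.abs_apply_le y]

/-- The map `φ` serves both operators: `φ = id` for `A`, and `φ y = (y, ±s)` for the pair generator.
-/
theorem RowBound.summable_mul_sub (hr : RowBound r R) {S : Type*} (f : BoundedFun S) (φ : E → S)
    (z : S) (x : E) : Summable fun y => r x y * (f (φ y) - f z) :=
  summable_mul_of_bounded (hr.summable x) fun y => f.abs_sub_le z (φ y)

theorem RowBound.abs_tsum_mul_sub_le (hr : RowBound r R) {S : Type*} (f : BoundedFun S)
    (φ : E → S) (z : S) (x : E) : |∑' y, r x y * (f (φ y) - f z)| ≤ R * (2 * ‖f‖) :=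
  abs_tsum_mul_le (hr.summable x) (hr.tsum_le x) (by positivity) fun y => f.abs_sub_le z (φ y)

theorem RowBound.tsum_mul_sub_add (hr : RowBound r R) {S : Type*} (f g : BoundedFun S)
    (φ : E → S) (z : S) (x : E) :
    ∑' y, r x y * ((f (φ y) + g (φ y)) - (f z + g z))
      = ∑' y, r x y * (f (φ y) - f z) + ∑' y, r x y * (g (φ y) - g z) := by
  rw [← (hr.summable_mul_sub f φ z x).tsum_add (hr.summable_mul_sub g φ z x)]
  exact tsum_congr fun y => by ring

theorem tsum_mul_sub_const_mul (a : E → ℝ) (c : ℝ) {S : Type*} (f : S → ℝ) (φ : E → S) (z : S) :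
    ∑' y, a y * (c * f (φ y) - c * f z) = c * ∑' y, a y * (f (φ y) - f z) := by
  rw [← tsum_mul_left]
  exact tsum_congr fun y => by ring

/-- The operator `A` as a bounded operator. -/
def signedCLM (hr : RowBound r R) (hV : ∀ x, |V x| ≤ K) : BoundedFun E →L[ℝ] BoundedFun E :=
  boundedOp (signedOp r V) (2 * R + K)
    (fun f g x => by
      simp only [signedOp]
      have h := hr.tsum_mul_sub_add f g id x x
      simp only [id] at h
      rw [h]
      ring)
    (fun c f x => by
      simp only [signedOp]
      have h := tsum_mul_sub_const_mul (r x) c f id x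
      simp only [id] at h
      rw [h]
      ring)
    (fun f x => by
      have h1 := hr.abs_tsum_mul_sub_le f id x x
      have h2 : |V x * f x| ≤ K * ‖f‖ := by
        rw [abs_mul]
        exact mul_le_mul (hV x) (f.abs_apply_le x) (abs_nonneg _) ((abs_nonneg _).trans (hV x))
      exact (abs_add_le _ _).trans ((add_le_add h1 h2).trans_eq (by ring)))

/-- The generator of the pair process as a bounded operator. -/
def pairGenCLM (hr : RowBound r R) : BoundedFun (E × ℤˣ) →L[ℝ] BoundedFun (E × ℤˣ) :=
  boundedOp (pairGen r) (4 * R)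
    (fun f g p => by
      simp only [pairGen]
      rw [hr.rPos.tsum_mul_sub_add f g (fun y => (y, p.2)) p p.1,
        hr.rNeg.tsum_mul_sub_add f g (fun y => (y, -p.2)) p p.1]
      ring)
    (fun c f p => by
      simp only [pairGen]
      rw [tsum_mul_sub_const_mul _ c f (fun y => (y, p.2)) p,
        tsum_mul_sub_const_mul _ c f (fun y => (y, -p.2)) p]
      ring)
    (fun f p => (abs_add_le _ _).trans ((add_le_add
      (hr.rPos.abs_tsum_mul_sub_le f (fun y => (y, p.2)) p p.1)
      (hr.rNeg.abs_tsum_mul_sub_le f (fun y => (y, -p.2)) p p.1)).trans_eq (by ring)))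

/-- The Feynman–Kac potential `2 ∑ r⁻(x, y) + V(x)`. -/
def potential (r : E → E → ℝ) (V : E → ℝ) (x : E) : ℝ := 2 * (∑' y, rNeg r x y) + V x

theorem RowBound.abs_potential_le (hr : RowBound r R) (hV : ∀ x, |V x| ≤ K) (x : E) :
    |potential r V x| ≤ 2 * R + K := by
  have h := abs_tsum_mul_le (d := fun _ => 1) (c := 1) (hr.rNeg.summable x) (hr.rNeg.tsum_le x)
    zero_le_one (by simp)
  simp only [mul_one] at h
  refine (abs_add_le _ _).trans (add_le_add ?_ (hV x))
  rw [abs_mul, abs_two]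
  gcongr

/-- The odd extension `(x, s) ↦ s f(x)`. -/
def oddExt : BoundedFun E →L[ℝ] BoundedFun (E × ℤˣ) :=
  boundedOp (fun f p => ((p.2 : ℤ) : ℝ) * f p.1) 1 (fun f g p => mul_add _ _ _)
    (fun c f p => by ring)
    (fun f p => by
      rw [abs_mul, one_mul]
      rcases Int.units_eq_one_or p.2 with h | h <;> simpa [h] using f.abs_apply_le p.1)

@[simp] theorem oddExt_apply (f : BoundedFun E) (p : E × ℤˣ) :
    oddExt f p = ((p.2 : ℤ) : ℝ) * f p.1 := rfl

/-- On odd extensions, the generator of the pair process plus the potential acts as `A`. -/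
theorem pairGen_add_potential_oddExt (hr : RowBound r R) (hV : ∀ x, |V x| ≤ K)
    {W : BoundedFun (E × ℤˣ)} (hW : ∀ p, W p = potential r V p.1) (f : BoundedFun E) :
    (pairGenCLM hr + mulOp W) (oddExt f) = oddExt (signedCLM hr hV f) := by
  ext ⟨x, s⟩
  change pairGen r (oddExt f) (x, s) + W (x, s) * (((s : ℤ) : ℝ) * f x)
    = ((s : ℤ) : ℝ) * signedOp r V f x
  rw [hW]
  simp only [pairGen, signedOp, potential, oddExt_apply, Units.val_neg, Int.cast_neg]
  set σ : ℝ := ((s : ℤ) : ℝ)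
  have hp : Summable fun y => rPos r x y * (f y - f x) := hr.rPos.summable_mul_sub f id x x
  have hn : Summable fun y => rNeg r x y * (f y - f x) := hr.rNeg.summable_mul_sub f id x x
  have hn1 : Summable fun y => rNeg r x y := by
    simpa using (hr.rNeg.summable x).of_abs
  have e1 : ∑' y, rPos r x y * (σ * f y - σ * f x) = σ * ∑' y, rPos r x y * (f y - f x) :=
    tsum_mul_sub_const_mul _ σ f id x
  -- The sign flip leaves the extra term `-2 σ f(x) ∑ r⁻`, exactly what the potential compensates.
  have e2 : ∑' y, rNeg r x y * (-σ * f y - σ * f x)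
      = -σ * ∑' y, rNeg r x y * (f y - f x) + -(2 * σ * f x) * ∑' y, rNeg r x y := by
    rw [← tsum_mul_left, ← tsum_mul_left, ← (hn.mul_left _).tsum_add (hn1.mul_left _)]
    exact tsum_congr fun y => by ring
  have e3 : ∑' y, r x y * (f y - f x)
      = ∑' y, rPos r x y * (f y - f x) - ∑' y, rNeg r x y * (f y - f x) := by
    rw [← hp.tsum_sub hn]
    exact tsum_congr fun y => by rw [← sub_mul, rPos_sub_rNeg]
  rw [e1, e2, e3]
  ring

/-- A finite supremum in `ℝ≥0∞` encodes both the summability of each row and the uniform bound. -/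
theorem RowBound.of_iSup_lt_top (h : (⨆ x, ∑' y, ENNReal.ofReal |r x y|) < ∞) :
    RowBound r (⨆ x, ∑' y, ENNReal.ofReal |r x y|).toReal := by
  have hle : ∀ x, ∑' y, ENNReal.ofReal |r x y| ≤ ⨆ x, ∑' y, ENNReal.ofReal |r x y| :=
    fun x => le_iSup (fun x => ∑' y, ENNReal.ofReal |r x y|) x
  have hs : ∀ x, Summable fun y => |r x y| := fun x => by
    simpa using ENNReal.summable_toReal ((hle x).trans_lt h).ne
  refine ⟨hs, fun x => ?_⟩
  have h1 := ENNReal.toReal_mono h.ne (hle x)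
  rwa [← ENNReal.ofReal_tsum_of_nonneg (fun _ => abs_nonneg _) (hs x),
    ENNReal.toReal_ofReal (tsum_nonneg fun _ => abs_nonneg _)] at h1

theorem abs_le_of_iSup_lt_top (h : (⨆ x, ENNReal.ofReal |V x|) < ∞) (x : E) :
    |V x| ≤ (⨆ x, ENNReal.ofReal |V x|).toReal := by
  have h1 := ENNReal.toReal_mono h.ne (le_iSup (fun x => ENNReal.ofReal |V x|) x)
  rwa [ENNReal.toReal_ofReal (abs_nonneg _)] at h1

end Rates

end SignedRates

end

/-! ### The signed-rate representation. -/

theorem theorem1 {E : Type*} [Countable E] [MeasurableSpace E] [DiscreteMeasurableSpace E]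
    (r : E → E → ℝ) (V : E → ℝ)
    (hr : (⨆ x, ∑' y, ENNReal.ofReal |r x y|) < ∞)
    (hV : (⨆ x, ENNReal.ofReal |V x|) < ∞)
    (hdiag : ∀ x, r x x = 0) :
    -- the sum defining `A f` converges absolutely for bounded `f`
    (∀ (f : SignedRates.BoundedFun E) (x : E), Summable fun y => r x y * (f y - f x)) ∧
    -- `A` is a bounded operator with respect to the supremum norm
    ∃ A : SignedRates.BoundedFun E →L[ℝ] SignedRates.BoundedFun E,
      (∀ f x, A f x = SignedRates.signedOp r V f x) ∧
      -- `S_t = e^{tA}` is well defined: the exponential series converges in operator norm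
      (∀ t : ℝ≥0, HasSum (fun n : ℕ => ((n.factorial : ℝ)⁻¹) • ((t : ℝ) • A) ^ n)
        (NormedSpace.exp ((t : ℝ) • A))) ∧
      -- the stochastic representation
      ∀ (x : E) (Ω : Type*) [MeasurableSpace Ω] (μ : Measure Ω) [IsProbabilityMeasure μ]
        (X : ℝ≥0 → Ω → E) (Z : ℝ≥0 → Ω → ℤˣ),
        SignedRates.IsMarkovProcessWithGenerator μ (SignedRates.pairGen r) (x, 1)
          (fun t ω => (X t ω, Z t ω)) →
        ∀ (f : SignedRates.BoundedFun E) (t : ℝ≥0),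
          (∀ ω, IntervalIntegrable (fun u : ℝ => 2 * (∑' y, SignedRates.rNeg r (X u.toNNReal ω) y)
            + V (X u.toNNReal ω)) volume 0 t) ∧
          Integrable (fun ω => ((Z t ω : ℤ) : ℝ) * f (X t ω) *
            Real.exp (∫ u in (0 : ℝ)..t, (2 * (∑' y, SignedRates.rNeg r (X u.toNNReal ω) y)
              + V (X u.toNNReal ω)))) μ ∧
          NormedSpace.exp ((t : ℝ) • A) f x =
            ∫ ω, ((Z t ω : ℤ) : ℝ) * f (X t ω) *
              Real.exp (∫ u in (0 : ℝ)..t, (2 * (∑' y, SignedRates.rNeg r (X u.toNNReal ω) y)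
                + V (X u.toNNReal ω))) ∂μ := by
  have hR := SignedRates.RowBound.of_iSup_lt_top hr
  have hK := SignedRates.abs_le_of_iSup_lt_top hV
  refine ⟨fun f x => hR.summable_mul_sub f id x x, SignedRates.signedCLM hR hK,
    fun _ _ => rfl, fun t => NormedSpace.exp_series_hasSum_exp' (𝕂 := ℝ) _, ?_⟩
  intro x Ω _ μ _ X Z hXZ f t
  obtain ⟨P, hP, hG, hY⟩ := hXZ
  let W : SignedRates.BoundedFun (E × ℤˣ) :=
    SignedRates.BoundedFun.mk (fun p => SignedRates.potential r V p.1)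
      ⟨_, fun p => hR.abs_potential_le hK p.1⟩
  obtain ⟨hint, heq⟩ := SignedRates.feynman_kac hP hG hY
    (L := SignedRates.pairGenCLM hR) (fun _ _ => rfl) W (SignedRates.oddExt f) t
  refine ⟨fun ω => SignedRates.intervalIntegrable_of_rightContinuous
    (fun s => hY.right_continuous ω s) W.abs_apply_le t.2, hint, ?_⟩
  -- The intertwining turns `e^{t(L + W)}` on the odd extension into the odd extension of `e^{tA}
  -- f`, whose sign factor at `(x, 1)` is `1`.
  rw [SignedRates.exp_comp_eq_comp_exp
    (SignedRates.pairGen_add_potential_oddExt hR hK fun _ => rfl) (t : ℝ) f] at heq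
  rw [SignedRates.oddExt_apply, Units.val_one, Int.cast_one, one_mul] at heq
  exact heq
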